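/- Let $n\ge 0$, let $\mathbf x$ be a random vector in $\mathbb R^n$ with $\mathbb E\|\mathbf x\|^2<\infty$, and let $\mathbf u$ be the sub-vector of $\mathbf x$ formed by an arbitrary set of its coordinates. Let $\mathbf r\sim\mathcal N(\boldsymbol\mu,\boldsymbol\Sigma)$ be independent of $\mathbf x$, where $\boldsymbol\mu\in\mathbb R^n$ and $\boldsymbol\Sigma=\mathrm{diag}(\sigma_1^2,\dots,\sigma_n^2)$ with all $\sigma_i>0$, and put $\mathbf x_c=\mathbf x+\mathbf r$. Write $I(X;Y)=D_{\mathrm{KL}}(P_{(X,Y)}\,\|\,P_X\otimes P_Y)$ for mutual information, with the natural logarithm. Consider the eigendecompositions $\mathrm{Cov}(\mathbf x)=Q\Lambda Q^{T}$, where $Q$ is a real orthogonal matrix and $\Lambda=\mathrm{diag}(\lambda_1,\dots,\lambda_n)$, so that $\lambda_1,\dots,\lambda_n$ are the eigenvalues of $\mathrm{Cov}(\mathbf x)$ with multiplicity, listed in the order given by the columns of $Q$. Then: 1. There is such a decomposition in which the eigenvalues are ordered oppositely to the noise levels, that is, $\lambda_i\ge\lambda_j$ whenever $\sigma_i<\sigma_j$.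 2. For every such decomposition in which either the eigenvalues are ordered oppositely to the noise levels (as in 1), or $Q\boldsymbol\Sigma=\boldsymbol\Sigma Q$ (for instance, $\mathrm{Cov}(\mathbf x)$ diagonal, $Q$ the identity and $\lambda_i=\mathrm{Var}(x_i)$), the mutual information $I(\mathbf x_c;\mathbf u)$ is finite and $$I(\mathbf x_c;\mathbf u)\ \le\ \frac12\log\Big((2\pi e)^n\prod_{i=1}^n\Big(1+\frac{\lambda_i}{\sigma_i^2}\Big)\Big).$$ -/

import Mathlib

open MeasureTheory ProbabilityTheory

/-- The mutual information `I(X; Y)` (in nats) of two random variables: the Kullback-Leibler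
divergence of their joint law from the product of their marginal laws. -/
noncomputable def mutualInformation {Ω α β : Type*} [MeasurableSpace Ω] [MeasurableSpace α]
    [MeasurableSpace β] (X : Ω → α) (Y : Ω → β) (P : Measure Ω) : ENNReal :=
  InformationTheory.klDiv (P.map (fun ω => (X ω, Y ω))) ((P.map X).prod (P.map Y))

/-- The covariance matrix of a random vector. -/
noncomputable def covarianceMatrix {Ω ι : Type*} [MeasurableSpace Ω]
    (X : Ω → EuclideanSpace ℝ ι) (P : Measure Ω) : Matrix ι ι ℝ :=
  Matrix.of fun i j => cov[fun ω => X ω i, fun ω => X ω j; P]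

/-- `A = Q Λ Qᵀ` with `Q` orthogonal and `Λ = diag(lam)`: the family `lam` lists the eigenvalues
of `A` with multiplicity, and the columns of `Q` are matching orthonormal eigenvectors. -/
def IsEigendecomposition {n : ℕ} (A Q : Matrix (Fin n) (Fin n) ℝ) (lam : Fin n → ℝ) : Prop :=
  Q ∈ Matrix.orthogonalGroup (Fin n) ℝ ∧ A = Q * Matrix.diagonal lam * Q.transpose

/-!
The mutual information is bounded by the capacity formula of the additive Gaussian channel. By data
processing (`mutualInformation_comp_right_le`), `u` may be replaced by `x`. The product of the
marginals is the closest product measure to the joint law of output and input with the given second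
marginal (`klDiv_prod_marginals_le`, a form of the chain rule), so replacing the law of `x + r` by
any other law `G` only increases the divergence. For `G` Gaussian with the mean and covariance of
`x + r`, all densities are explicit and the expected logarithms depend on the covariances alone
(`integrable_and_integral_gaussianLogDensity`), which leaves
`I(x + r; x) ≤ (log det (C + D) - log det D) / 2`, where `C` is the covariance of `x` and `D` the
diagonal one of `r` (`mutualInformation_add_gaussian_le`).

It remains to bound `det (C + D)`. If `Q` commutes with `D`, it equals `∏ (lam i + σ i ^ 2)`. If the
eigenvalues are ordered oppositely to the noise levels, Fiedler's inequality bounds it by the same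
product; since the claim leaves a factor `2 π e` per dimension, the weaker bound with a factor `2`
per dimension (`Matrix.det_conj_diagonal_add_diagonal_le_of_antivary`) is enough. Opposite ordering
provides a number `t > 0` that separates `lam i` from `σ i ^ 2` for every `i`. After raising
all eigenvalues of `C` and `D` to at least `t`, the identity `X + Y = X (X⁻¹ + Y⁻¹) Y` together with
`X⁻¹ + Y⁻¹ ≤ 2 / t` reduces the bound to one for numbers.
-/

/-! ### Determinants and the Loewner order -/

section Determinant

open Matrix

variable {ι : Type*} [Fintype ι] [DecidableEq ι]

lemma Matrix.PosSemidef.det_le_one {A : Matrix ι ι ℝ} (hA : A.PosSemidef)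
    (h : (1 - A).PosSemidef) : A.det ≤ 1 := by
  rw [hA.isHermitian.det_eq_prod_eigenvalues]
  refine Finset.prod_le_one (fun i _ => hA.eigenvalues_nonneg i) fun i _ => ?_
  have hv := h.dotProduct_mulVec_nonneg (hA.isHermitian.eigenvectorBasis i)
  have hone : star (⇑(hA.isHermitian.eigenvectorBasis i)) ⬝ᵥ
      (⇑(hA.isHermitian.eigenvectorBasis i)) = 1 := by
    have := hA.isHermitian.eigenvectorBasis.inner_eq_one i
    rw [EuclideanSpace.inner_eq_star_dotProduct] at this
    rwa [dotProduct_comm]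
  rw [sub_mulVec, one_mulVec, hA.isHermitian.mulVec_eigenvectorBasis, dotProduct_sub,
    dotProduct_smul, hone] at hv
  simpa using hv

/-- The determinant is monotone on positive semidefinite matrices: conjugating `A ≤ B` by the
inverse square root of `B` reduces the claim to `B = 1`. -/
lemma Matrix.PosSemidef.det_le_det {A B : Matrix ι ι ℝ} (hA : A.PosSemidef) (hB : B.PosDef)
    (h : (B - A).PosSemidef) : A.det ≤ B.det := by
  obtain ⟨R, hR, hRR⟩ : ∃ R : Matrix ι ι ℝ, Rᴴ = R ∧ R * R = B := by
    open scoped MatrixOrder in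
    exact ⟨CFC.sqrt B, (CFC.sqrt_nonneg B).isSelfAdjoint,
      CFC.sqrt_mul_sqrt_self B hB.posSemidef.nonneg⟩
  have hdet : R.det * R.det = B.det := by rw [← det_mul, hRR]
  have hBpos := hB.det_pos
  have hRu : IsUnit R.det := by
    rw [isUnit_iff_ne_zero]
    intro h0
    simp [h0] at hdet
    exact hBpos.ne hdet
  have hinvH : (R⁻¹)ᴴ = R⁻¹ := by rw [conjTranspose_nonsing_inv, hR]
  have h1 : (R⁻¹ * A * R⁻¹).PosSemidef := by
    have := hA.mul_mul_conjTranspose_same R⁻¹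
    rwa [hinvH] at this
  have h2 : (1 - R⁻¹ * A * R⁻¹).PosSemidef := by
    have := h.mul_mul_conjTranspose_same R⁻¹
    rw [hinvH, Matrix.mul_sub, Matrix.sub_mul, ← hRR, ← Matrix.mul_assoc,
      nonsing_inv_mul _ hRu, Matrix.one_mul, mul_nonsing_inv _ hRu] at this
    exact this
  have h3 := h1.det_le_one h2
  rw [det_mul, det_mul, det_nonsing_inv, Ring.inverse_eq_inv'] at h3
  have hR0 : R.det ≠ 0 := hRu.ne_zero
  have : A.det / B.det ≤ 1 := by
    rw [← hdet]
    calc A.det / (R.det * R.det) = (R.det)⁻¹ * A.det * (R.det)⁻¹ := by field_simp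
      _ ≤ 1 := h3
  rwa [div_le_one hBpos] at this

lemma Matrix.posSemidef_mul_diagonal_mul_transpose (Q : Matrix ι ι ℝ) {d : ι → ℝ}
    (hd : ∀ i, 0 ≤ d i) : (Q * diagonal d * Qᵀ).PosSemidef := by
  simpa using (PosSemidef.diagonal (n := ι) (d := d) hd).mul_mul_conjTranspose_same Q

lemma Matrix.det_mul_diagonal_mul_transpose {Q : Matrix ι ι ℝ}
    (hQ : Q ∈ orthogonalGroup ι ℝ) (d : ι → ℝ) : (Q * diagonal d * Qᵀ).det = ∏ i, d i := by
  have h : Q.det * Q.det = 1 := by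
    have := congrArg Matrix.det ((mem_orthogonalGroup_iff ι ℝ).1 hQ)
    simpa [star_eq_conjTranspose] using this
  rw [det_mul, det_mul, det_transpose, det_diagonal]
  linear_combination (∏ i, d i) * h

/-- With `X = Q diag(a) Qᵀ` and `Y = diag(b)`, the factorization `X + Y = X (X⁻¹ + Y⁻¹) Y` and
`X⁻¹ + Y⁻¹ ≤ 2 / t` give the bound. -/
lemma Matrix.det_conj_diagonal_add_diagonal_le_of_le {Q : Matrix ι ι ℝ}
    (hQ : Q ∈ orthogonalGroup ι ℝ) {a b : ι → ℝ} {t : ℝ} (ht : 0 < t)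
    (ha : ∀ i, t ≤ a i) (hb : ∀ i, t ≤ b i) :
    (Q * diagonal a * Qᵀ + diagonal b).det ≤ ∏ i, (2 / t * (a i * b i)) := by
  have hQ1 : Q * Qᵀ = 1 := by simpa [star_eq_conjTranspose] using (mem_orthogonalGroup_iff ι ℝ).1 hQ
  have hQ2 : Qᵀ * Q = 1 := by
    simpa [star_eq_conjTranspose] using (mem_orthogonalGroup_iff' ι ℝ).1 hQ
  have ha0 i : 0 < a i := ht.trans_le (ha i)
  have hb0 i : 0 < b i := ht.trans_le (hb i)
  have hfac : Q * diagonal a * Qᵀ + diagonal b =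
      (Q * diagonal a * Qᵀ) * (Q * diagonal (fun i => (a i)⁻¹) * Qᵀ + diagonal fun i => (b i)⁻¹) *
        diagonal b := by
    have h1 : (Q * diagonal a * Qᵀ) * (Q * diagonal (fun i => (a i)⁻¹) * Qᵀ) = 1 := by
      calc _ = Q * diagonal a * (Qᵀ * Q) * diagonal (fun i => (a i)⁻¹) * Qᵀ := by
            simp only [Matrix.mul_assoc]
        _ = Q * (diagonal a * diagonal (fun i => (a i)⁻¹)) * Qᵀ := by
            rw [hQ2, Matrix.mul_one, Matrix.mul_assoc Q]
        _ = 1 := by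
            rw [diagonal_mul_diagonal]
            simp [fun i => mul_inv_cancel₀ (ha0 i).ne', hQ1]
    rw [Matrix.mul_add, h1, Matrix.add_mul, Matrix.one_mul,
      Matrix.mul_assoc _ (diagonal _) (diagonal b), diagonal_mul_diagonal]
    simp [fun i => inv_mul_cancel₀ (hb0 i).ne', add_comm]
  have hM : (Q * diagonal (fun i => (a i)⁻¹) * Qᵀ + diagonal fun i => (b i)⁻¹).det
      ≤ ∏ _i : ι, (2 / t) := by
    rw [← det_diagonal]
    refine PosSemidef.det_le_det ?_ ?_ ?_
    · exact (posSemidef_mul_diagonal_mul_transpose Q fun i => (inv_pos.2 (ha0 i)).le).add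
        (PosSemidef.diagonal fun i => (inv_pos.2 (hb0 i)).le)
    · exact PosDef.diagonal fun i => by positivity
    · have : diagonal (fun _ : ι => 2 / t) -
          (Q * diagonal (fun i => (a i)⁻¹) * Qᵀ + diagonal fun i => (b i)⁻¹) =
          Q * diagonal (fun i => t⁻¹ - (a i)⁻¹) * Qᵀ + diagonal fun i => t⁻¹ - (b i)⁻¹ := by
        have e1 : diagonal (fun i => t⁻¹ - (a i)⁻¹) =
            t⁻¹ • (1 : Matrix ι ι ℝ) - diagonal fun i => (a i)⁻¹ := by
          rw [smul_one_eq_diagonal, diagonal_sub]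
        have e2 : diagonal (fun i => t⁻¹ - (b i)⁻¹) =
            t⁻¹ • (1 : Matrix ι ι ℝ) - diagonal fun i => (b i)⁻¹ := by
          rw [smul_one_eq_diagonal, diagonal_sub]
        have e3 : diagonal (fun _ : ι => 2 / t) = (2 / t) • (1 : Matrix ι ι ℝ) := by
          rw [smul_one_eq_diagonal]
        rw [e1, e2, e3, Matrix.mul_sub, Matrix.sub_mul, Matrix.mul_smul, Matrix.smul_mul,
          Matrix.mul_one, hQ1, div_eq_mul_inv, two_mul, add_smul]
        abel
      rw [this]
      exact (posSemidef_mul_diagonal_mul_transpose Q fun i =>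
        sub_nonneg.2 (inv_anti₀ ht (ha i))).add
        (PosSemidef.diagonal fun i => sub_nonneg.2 (inv_anti₀ ht (hb i)))
  rw [hfac, det_mul, det_mul, det_mul_diagonal_mul_transpose hQ, det_diagonal,
    Finset.prod_mul_distrib, Finset.prod_mul_distrib, mul_right_comm, mul_comm]
  exact mul_le_mul_of_nonneg_right hM (mul_nonneg (Finset.prod_nonneg fun i _ => (ha0 i).le)
    (Finset.prod_nonneg fun i _ => (hb0 i).le))

/-- A version of Fiedler's inequality `det (A + B) ≤ ∏ (αᵢ + βᵢ)` for oppositely ordered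
eigenvalues, up to a factor `2` per dimension. Some `t > 0` separates every pair
`(l i, s i)`; raising all eigenvalues to at least `t` increases the determinant, and
`max (l i) t * max (s i) t = t * max (l i) (s i)`. -/
lemma Matrix.det_conj_diagonal_add_diagonal_le_of_antivary {Q : Matrix ι ι ℝ}
    (hQ : Q ∈ orthogonalGroup ι ℝ) {l s : ι → ℝ} (hl : ∀ i, 0 ≤ l i) (hs : ∀ i, 0 < s i)
    (h : Antivary l s) :
    (Q * diagonal l * Qᵀ + diagonal s).det ≤ ∏ i, (2 * (l i + s i)) := by
  rcases isEmpty_or_nonempty ι with hι | hι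
  · simp
  -- antitone dependence makes the intervals between `l i` and `s i` meet pairwise, so the least of
  -- their right endpoints lies in all of them
  obtain ⟨i₀, hi₀⟩ := Finite.exists_min fun i => max (l i) (s i)
  set t := max (l i₀) (s i₀)
  have ht : 0 < t := lt_max_of_lt_right (hs i₀)
  have hmin i : min (l i) (s i) ≤ t := by
    by_contra! hc
    obtain ⟨h1, h2⟩ := lt_min_iff.1 hc
    exact (h ((le_max_right _ _).trans_lt h2)).not_gt ((le_max_left _ _).trans_lt h1)
  have hdiff : (Q * diagonal (fun i => max (l i) t) * Qᵀ + diagonal fun i => max (s i) t) -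
      (Q * diagonal l * Qᵀ + diagonal s) =
      Q * diagonal (fun i => max (l i) t - l i) * Qᵀ + diagonal fun i => max (s i) t - s i := by
    rw [← diagonal_sub, ← diagonal_sub, Matrix.mul_sub, Matrix.sub_mul]
    abel
  calc (Q * diagonal l * Qᵀ + diagonal s).det
      ≤ (Q * diagonal (fun i => max (l i) t) * Qᵀ + diagonal fun i => max (s i) t).det := by
        refine PosSemidef.det_le_det ?_ ?_ ?_
        · exact (posSemidef_mul_diagonal_mul_transpose Q hl).add
            (PosSemidef.diagonal fun i => (hs i).le)
        · exact PosDef.posSemidef_add (posSemidef_mul_diagonal_mul_transpose Q fun i =>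
            ht.le.trans (le_max_right _ _)) (PosDef.diagonal fun i => lt_max_of_lt_right ht)
        · rw [hdiff]
          exact (posSemidef_mul_diagonal_mul_transpose Q fun i =>
            sub_nonneg.2 (le_max_left _ _)).add
            (PosSemidef.diagonal fun i => sub_nonneg.2 (le_max_left _ _))
    _ ≤ ∏ i, (2 / t * (max (l i) t * max (s i) t)) :=
        det_conj_diagonal_add_diagonal_le_of_le hQ ht (fun i => le_max_right _ _)
          (fun i => le_max_right _ _)
    _ ≤ ∏ i, (2 * (l i + s i)) := by
        refine Finset.prod_le_prod (fun i _ => ?_) fun i _ => ?_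
        · have : 0 < max (l i) t := lt_max_of_lt_right ht
          have : 0 < max (s i) t := lt_max_of_lt_right ht
          positivity
        · have key : max (l i) t * max (s i) t ≤ t * (l i + s i) := by
            rcases le_total (l i) (s i) with hls | hls
            · have h1 : l i ≤ t := by simpa [hls] using hmin i
              have h2 : t ≤ s i := by simpa [hls] using hi₀ i
              rw [max_eq_right h1, max_eq_left h2]
              nlinarith [hl i]
            · have h1 : s i ≤ t := by simpa [hls] using hmin i
              have h2 : t ≤ l i := by simpa [hls] using hi₀ i
              rw [max_eq_left h2, max_eq_right h1]
              nlinarith [hs i]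
          calc 2 / t * (max (l i) t * max (s i) t) ≤ 2 / t * (t * (l i + s i)) := by gcongr
            _ = 2 * (l i + s i) := by field_simp

lemma Matrix.det_conj_diagonal_add_diagonal_of_commute {Q : Matrix ι ι ℝ}
    (hQ : Q ∈ orthogonalGroup ι ℝ) {l s : ι → ℝ} (h : Commute Q (diagonal s)) :
    (Q * diagonal l * Qᵀ + diagonal s).det = ∏ i, (l i + s i) := by
  have hQ1 : Q * Qᵀ = 1 := by simpa [star_eq_conjTranspose] using (mem_orthogonalGroup_iff ι ℝ).1 hQ
  have : diagonal s = Q * diagonal s * Qᵀ := by rw [h.eq, Matrix.mul_assoc, hQ1, Matrix.mul_one]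
  rw [this, ← Matrix.add_mul, ← Matrix.mul_add, diagonal_add, det_mul_diagonal_mul_transpose hQ]

/-- Sorting the eigenvalues of the spectral theorem against `σ`. -/
lemma Matrix.IsHermitian.exists_isEigendecomposition_antivary {n : ℕ}
    {A : Matrix (Fin n) (Fin n) ℝ} (hA : A.IsHermitian) (σ : Fin n → ℝ) :
    ∃ (Q : Matrix (Fin n) (Fin n) ℝ) (lam : Fin n → ℝ),
      IsEigendecomposition A Q lam ∧ Antivary lam σ := by
  let τ := Tuple.sort σ
  let ρ := Tuple.sort fun i => -hA.eigenvalues i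
  let π : Equiv.Perm (Fin n) := τ⁻¹.trans ρ
  let V : Matrix (Fin n) (Fin n) ℝ := hA.eigenvectorUnitary
  have hV : V * Vᵀ = 1 := by
    simpa [star_eq_conjTranspose] using (mem_orthogonalGroup_iff (Fin n) ℝ).1 hA.eigenvectorUnitary.2
  refine ⟨V.submatrix id π, hA.eigenvalues ∘ π, ⟨?_, ?_⟩, ?_⟩
  · rw [mem_orthogonalGroup_iff]
    rw [transpose_submatrix, submatrix_mul_equiv, hV, submatrix_id_id]
  · have h := hA.spectral_theorem
    rw [Unitary.conjStarAlgAut_apply] at h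
    have hd : diagonal (hA.eigenvalues ∘ π) = (diagonal hA.eigenvalues).submatrix π π := by
      rw [submatrix_diagonal_equiv]
    rw [hd, submatrix_mul_equiv, transpose_submatrix, submatrix_mul_equiv, submatrix_id_id]
    simpa [star_eq_conjTranspose] using h
  · intro i j hij
    have hσ : Monotone (σ ∘ τ) := Tuple.monotone_sort σ
    have hρ : Monotone ((fun i => -hA.eigenvalues i) ∘ ρ) := Tuple.monotone_sort _
    have hlt : τ⁻¹ i ≤ τ⁻¹ j := by
      by_contra! hc
      have := hσ hc.le
      simp only [Function.comp_apply, ← Equiv.Perm.mul_apply, mul_inv_cancel, Equiv.Perm.one_apply]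
        at this
      exact this.not_gt hij
    simpa [π] using hρ hlt

end Determinant

/-! ### Density of the multivariate Gaussian -/

section Density

open Matrix Module
open scoped RealInnerProductSpace MatrixOrder

lemma MeasureTheory.Measure.map_withDensity_comp {α β : Type*} [MeasurableSpace α]
    [MeasurableSpace β] (μ : Measure α) (e : α ≃ᵐ β) {f : β → ENNReal} (hf : Measurable f) :
    (μ.withDensity fun a => f (e a)).map e = (μ.map e).withDensity f := by
  ext s hs
  rw [Measure.map_apply e.measurable hs, withDensity_apply _ (e.measurable hs),
    withDensity_apply _ hs, setLIntegral_map hs hf e.measurable]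

/-- Both sides are finite measures with the characteristic function `t ↦ exp (-‖t‖² / 2)`. -/
lemma ProbabilityTheory.stdGaussian_eq_withDensity {E : Type*} [NormedAddCommGroup E]
    [InnerProductSpace ℝ E] [FiniteDimensional ℝ E] [MeasurableSpace E] [BorelSpace E] :
    stdGaussian E = volume.withDensity fun x : E => ENNReal.ofReal
      (Real.exp (-(finrank ℝ E * Real.log (2 * Real.pi) + ‖x‖ ^ 2) / 2)) := by
  set N : ℝ := (finrank ℝ E : ℝ)
  have hsplit (x : E) : Real.exp (-(N * Real.log (2 * Real.pi) + ‖x‖ ^ 2) / 2) =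
      Real.exp (-(N * Real.log (2 * Real.pi)) / 2) * Real.exp (-(1 / 2) * ‖x‖ ^ 2) := by
    rw [← Real.exp_add]; ring_nf
  have hint : Integrable (fun x : E => Real.exp (-(1 / 2) * ‖x‖ ^ 2)) := by
    refine Integrable.of_integral_ne_zero ?_
    rw [GaussianFourier.integral_rexp_neg_mul_sq_norm (by norm_num)]
    positivity
  have hint' : Integrable fun x : E =>
      Real.exp (-(N * Real.log (2 * Real.pi) + ‖x‖ ^ 2) / 2) := by
    simp_rw [hsplit]
    exact hint.const_mul _
  have := isFiniteMeasure_withDensity_ofReal hint'.2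
  apply Measure.ext_of_charFun
  ext t
  rw [charFun_stdGaussian, charFun_apply, integral_withDensity_eq_integral_toReal_smul
    (by fun_prop) (by simp)]
  have hcongr (x : E) : (ENNReal.ofReal
      (Real.exp (-(N * Real.log (2 * Real.pi) + ‖x‖ ^ 2) / 2))).toReal •
        Complex.exp (⟪x, t⟫ * Complex.I) = (Real.exp (-(N * Real.log (2 * Real.pi)) / 2) : ℂ) *
        Complex.exp (-(1 / 2) * ‖x‖ ^ 2 + Complex.I * ⟪t, x⟫) := by
    rw [ENNReal.toReal_ofReal (Real.exp_nonneg _), hsplit, Complex.real_smul, Complex.exp_add,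
      real_inner_comm]
    push_cast
    ring_nf
  simp_rw [hcongr]
  rw [integral_const_mul, GaussianFourier.integral_cexp_neg_mul_sq_norm_add (by norm_num)]
  have hpi : (Real.exp (-(N * Real.log (2 * Real.pi)) / 2) : ℂ) *
      (Real.pi / (1 / 2) : ℂ) ^ (finrank ℝ E / 2 : ℂ) = 1 := by
    have h1 : (Real.pi / (1 / 2) : ℂ) = ((2 * Real.pi : ℝ) : ℂ) := by push_cast; ring
    have h2 : (finrank ℝ E / 2 : ℂ) = ((N / 2 : ℝ) : ℂ) := by simp [N]
    rw [h1, h2, ← Complex.ofReal_cpow (by positivity), ← Complex.ofReal_mul,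
      Real.rpow_def_of_pos (by positivity), ← Real.exp_add]
    ring_nf
    simp
  rw [← mul_assoc, hpi, one_mul]
  congr 1
  rw [Complex.I_sq]
  ring

variable {ι : Type*} [Fintype ι] [DecidableEq ι]

/-- The logarithm of the density of the Gaussian distribution on `ℝ^ι` with mean `c` and positive
definite covariance matrix `S`. -/
noncomputable def gaussianLogDensity (c : EuclideanSpace ℝ ι) (S : Matrix ι ι ℝ)
    (y : EuclideanSpace ℝ ι) : ℝ :=
  -(Fintype.card ι * Real.log (2 * Real.pi) + Real.log S.det +
    ∑ i, ∑ j, S⁻¹ i j * ((y i - c i) * (y j - c j))) / 2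

@[fun_prop]
lemma measurable_gaussianLogDensity (c : EuclideanSpace ℝ ι) (S : Matrix ι ι ℝ) :
    Measurable (gaussianLogDensity c S) := by
  unfold gaussianLogDensity
  fun_prop

/-- The affine map `x ↦ c + √S x` carries the standard Gaussian to `N(c, S)` and scales the volume
by `√(det S)`. -/
lemma ProbabilityTheory.multivariateGaussian_eq_withDensity (c : EuclideanSpace ℝ ι)
    {S : Matrix ι ι ℝ} (hS : S.PosDef) :
    multivariateGaussian c S =
      volume.withDensity fun y => ENNReal.ofReal (Real.exp (gaussianLogDensity c S y)) := by
  obtain ⟨R, hR_def, hR, hRR⟩ : ∃ R : Matrix ι ι ℝ, CFC.sqrt S = R ∧ Rᴴ = R ∧ R * R = S := by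
    exact ⟨CFC.sqrt S, rfl, (CFC.sqrt_nonneg S).isSelfAdjoint,
      CFC.sqrt_mul_sqrt_self S hS.posSemidef.nonneg⟩
  have hdet : R.det * R.det = S.det := by rw [← det_mul, hRR]
  have hSpos := hS.det_pos
  have hR0 : R.det ≠ 0 := by
    intro h0
    simp [h0] at hdet
    exact hSpos.ne hdet
  have hRu : IsUnit R.det := isUnit_iff_ne_zero.2 hR0
  let L : EuclideanSpace ℝ ι →ₗ[ℝ] EuclideanSpace ℝ ι := Matrix.toEuclideanLin R
  have hLdet : LinearMap.det L = R.det := by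
    simp [L, Matrix.toEuclideanLin_eq_toLin_orthonormal, LinearMap.det_toLin]
  let e : EuclideanSpace ℝ ι ≃ᵐ EuclideanSpace ℝ ι :=
    ((LinearEquiv.ofIsUnitDet (f := L) (v := (EuclideanSpace.basisFun ι ℝ).toBasis)
      (v' := (EuclideanSpace.basisFun ι ℝ).toBasis)
      (by rw [LinearMap.det_toMatrix, hLdet]; exact hRu)).toContinuousLinearEquiv.toHomeomorph.trans
      (Homeomorph.addLeft c)).toMeasurableEquiv
  have he (x) : e x = c + L x := rfl
  have hvol : (volume : Measure (EuclideanSpace ℝ ι)).map e =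
      ENNReal.ofReal |R.det|⁻¹ • volume := by
    have : (e : EuclideanSpace ℝ ι → _) = (fun x => c + x) ∘ L := rfl
    rw [this, ← Measure.map_map (by fun_prop) L.continuous_of_finiteDimensional.measurable,
      Measure.map_linearMap_addHaar_eq_smul_addHaar _ (by rwa [hLdet]), Measure.map_smul,
      map_add_left_eq_self, hLdet, abs_inv]
  -- the quadratic form of `S⁻¹` at `√S x` is `‖x‖²`
  have hquad (x : EuclideanSpace ℝ ι) :
      ∑ i, ∑ j, S⁻¹ i j * ((e x i - c i) * (e x j - c j)) = ‖x‖ ^ 2 := by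
    have h1 (i : ι) : e x i - c i = (R *ᵥ x) i := by
      simp [he, L, Matrix.toLpLin_apply]
    simp_rw [h1]
    have h2 (v : ι → ℝ) : ∑ i, ∑ j, S⁻¹ i j * (v i * v j) = v ⬝ᵥ (S⁻¹ *ᵥ v) := by
      simp only [dotProduct, mulVec, Finset.mul_sum]
      refine Finset.sum_congr rfl fun i _ => Finset.sum_congr rfl fun j _ => ?_
      ring
    have h3 : Rᵀ * S⁻¹ * R = 1 := by
      rw [← hRR, Matrix.mul_inv_rev, ← conjTranspose_eq_transpose_of_trivial, hR,
        mul_nonsing_inv_cancel_left _ _ hRu, nonsing_inv_mul _ hRu]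
    rw [h2, ← vecMul_transpose R x.ofLp, ← dotProduct_mulVec, vecMul_transpose, mulVec_mulVec,
      mulVec_mulVec, h3, one_mulVec, EuclideanSpace.real_norm_sq_eq]
    simp [dotProduct, sq]
  have hden (x : EuclideanSpace ℝ ι) :
      ENNReal.ofReal |R.det| * ENNReal.ofReal (Real.exp (gaussianLogDensity c S (e x))) =
        ENNReal.ofReal (Real.exp (-(finrank ℝ (EuclideanSpace ℝ ι) * Real.log (2 * Real.pi) +
          ‖x‖ ^ 2) / 2)) := by
    have hlog : Real.log S.det = 2 * Real.log |R.det| := by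
      rw [← hdet, Real.log_mul hR0 hR0, Real.log_abs]; ring
    rw [← ENNReal.ofReal_mul (abs_nonneg _), gaussianLogDensity, hquad, hlog,
      finrank_euclideanSpace]
    nth_rw 1 [← Real.exp_log (abs_pos.2 hR0)]
    rw [← Real.exp_add]
    ring_nf
  have hmeas : Measurable fun y => ENNReal.ofReal (Real.exp (gaussianLogDensity c S y)) := by
    fun_prop
  rw [multivariateGaussian, hR_def, stdGaussian_eq_withDensity]
  simp_rw [← hden]
  change Measure.map e _ = _
  rw [Measure.map_withDensity_comp volume e
    (f := fun y => ENNReal.ofReal |R.det| * ENNReal.ofReal (Real.exp (gaussianLogDensity c S y)))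
    (hmeas.const_mul _), hvol, withDensity_smul_measure]
  have hconst : (fun y => ENNReal.ofReal |R.det| *
      ENNReal.ofReal (Real.exp (gaussianLogDensity c S y))) = ENNReal.ofReal |R.det| •
      fun y => ENNReal.ofReal (Real.exp (gaussianLogDensity c S y)) := rfl
  rw [hconst, withDensity_smul _ hmeas, smul_smul, ← ENNReal.ofReal_mul (by positivity),
    inv_mul_cancel₀ (abs_ne_zero.2 hR0), ENNReal.ofReal_one, one_smul]

end Density

/-! ### Mean and covariance of a random vector -/

section Moments

open Matrix

variable {Ω ι : Type*} [MeasurableSpace Ω] {P : Measure Ω}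

lemma MeasureTheory.MemLp.euclideanSpace_apply [Fintype ι] {y : Ω → EuclideanSpace ℝ ι}
    (hy : MemLp y 2 P) (i : ι) : MemLp (fun ω => y ω i) 2 P :=
  hy.continuousLinearMap_comp (EuclideanSpace.proj (𝕜 := ℝ) i)

lemma isHermitian_covarianceMatrix (y : Ω → EuclideanSpace ℝ ι) :
    (covarianceMatrix y P).IsHermitian := by
  ext i j
  simp [covarianceMatrix, covariance_comm]

variable [Fintype ι] [IsProbabilityMeasure P]

lemma posSemidef_covarianceMatrix {y : Ω → EuclideanSpace ℝ ι} (hy : MemLp y 2 P) :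
    (covarianceMatrix y P).PosSemidef := by
  refine PosSemidef.of_dotProduct_mulVec_nonneg (isHermitian_covarianceMatrix y) fun v => ?_
  have hv : star v ⬝ᵥ (covarianceMatrix y P *ᵥ v) =
      cov[fun ω => ∑ i, v i * y ω i, fun ω => ∑ i, v i * y ω i; P] := by
    rw [covariance_fun_sum_fun_sum (fun i => (hy.euclideanSpace_apply i).const_mul _)
      (fun i => (hy.euclideanSpace_apply i).const_mul _)]
    simp only [dotProduct, mulVec, Finset.mul_sum, covarianceMatrix, of_apply,
      covariance_const_mul_left, covariance_const_mul_right, star_trivial]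
    exact Finset.sum_congr rfl fun i _ => Finset.sum_congr rfl fun j _ => by ring
  rw [hv, covariance_self]
  · exact variance_nonneg _ _
  · exact Finset.aemeasurable_fun_sum _ fun i _ =>
      ((hy.euclideanSpace_apply i).const_mul _).aestronglyMeasurable.aemeasurable

lemma covarianceMatrix_add_of_indepFun {y z : Ω → EuclideanSpace ℝ ι} (hy : MemLp y 2 P)
    (hz : MemLp z 2 P) (h : IndepFun y z P) :
    covarianceMatrix (fun ω => y ω + z ω) P = covarianceMatrix y P + covarianceMatrix z P := by
  ext i j
  have hyi := hy.euclideanSpace_apply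
  have hzi := hz.euclideanSpace_apply
  have hind (i j : ι) : cov[fun ω => y ω i, fun ω => z ω j; P] = 0 :=
    IndepFun.covariance_eq_zero (h.comp (φ := fun v : EuclideanSpace ℝ ι => v i)
      (ψ := fun v : EuclideanSpace ℝ ι => v j) (by fun_prop) (by fun_prop)) (hyi i) (hzi j)
  have h1 := covariance_add_left (hyi i) (hzi i) ((hyi j).add (hzi j))
  have h2 := covariance_add_right (hyi i) (hyi j) (hzi j)
  have h3 := covariance_add_right (hzi i) (hyi j) (hzi j)
  rw [h2, h3, hind, covariance_comm (fun ω => z ω i), hind, add_zero,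
    zero_add] at h1
  exact h1

variable [DecidableEq ι]

/-- The cross-entropy of any law relative to the Gaussian with the same mean and covariance depends
only on the covariance, since `𝔼 ⟨y - c, S⁻¹ (y - c)⟩ = tr (S⁻¹ S)`. -/
lemma integrable_and_integral_gaussianLogDensity {y : Ω → EuclideanSpace ℝ ι} (hy : MemLp y 2 P)
    {c : EuclideanSpace ℝ ι} (hc : ∀ i, ∫ ω, y ω i ∂P = c i) {S : Matrix ι ι ℝ}
    (hS : covarianceMatrix y P = S) (hpos : S.PosDef) :
    Integrable (fun ω => gaussianLogDensity c S (y ω)) P ∧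
      ∫ ω, gaussianLogDensity c S (y ω) ∂P =
        -(Fintype.card ι * Real.log (2 * Real.pi) + Real.log S.det + Fintype.card ι) / 2 := by
  have hint (i j : ι) : Integrable (fun ω => S⁻¹ i j * ((y ω i - c i) * (y ω j - c j))) P :=
    (((hy.euclideanSpace_apply i).sub (memLp_const _)).integrable_mul
      ((hy.euclideanSpace_apply j).sub (memLp_const _))).const_mul _
  have hint' : Integrable (fun ω => ∑ i, ∑ j, S⁻¹ i j * ((y ω i - c i) * (y ω j - c j))) P :=
    integrable_finsetSum _ fun i _ => integrable_finsetSum _ fun j _ => hint i j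
  have hcov (i j : ι) : ∫ ω, (y ω i - c i) * (y ω j - c j) ∂P = S j i := by
    rw [← hS, ← hc, ← hc]
    simp only [covarianceMatrix, of_apply, covariance]
    exact integral_congr_ae (.of_forall fun ω => mul_comm _ _)
  have hquad : ∫ ω, ∑ i, ∑ j, S⁻¹ i j * ((y ω i - c i) * (y ω j - c j)) ∂P = Fintype.card ι := by
    rw [integral_finsetSum _ fun i _ => integrable_finsetSum _ fun j _ => hint i j]
    simp_rw [integral_finsetSum _ fun j _ => hint _ j, integral_const_mul, hcov]
    have := congrArg Matrix.trace (nonsing_inv_mul S ((isUnit_iff_isUnit_det S).1 hpos.isUnit))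
    rw [trace_one] at this
    rw [← this]
    simp [Matrix.trace, Matrix.mul_apply]
  unfold gaussianLogDensity
  refine ⟨(((integrable_const _).add hint').neg).div_const 2, ?_⟩
  rw [integral_div, integral_neg, integral_add (integrable_const _) hint', hquad]
  simp

end Moments

/-! ### Mutual information of a vector observed in additive noise -/

section Information

open InformationTheory

variable {α β : Type*} [MeasurableSpace α] [MeasurableSpace β]

lemma InformationTheory.klDiv_withDensity_exp {ρ μ ν : Measure α} [IsProbabilityMeasure μ]
    [IsProbabilityMeasure ν] {f g : α → ℝ} (hf : Measurable f) (hg : Measurable g)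
    (hμ : μ = ρ.withDensity fun a => ENNReal.ofReal (Real.exp (f a)))
    (hν : ν = ρ.withDensity fun a => ENNReal.ofReal (Real.exp (g a)))
    (hint : Integrable (fun a => f a - g a) μ) :
    klDiv μ ν = ENNReal.ofReal (∫ a, f a - g a ∂μ) := by
  have hμν : μ = ν.withDensity fun a => ENNReal.ofReal (Real.exp (f a - g a)) := by
    rw [hν, ← withDensity_mul _ (by fun_prop) (by fun_prop), hμ]
    congr 1
    ext a
    rw [Pi.mul_apply, ← ENNReal.ofReal_mul (Real.exp_nonneg _), ← Real.exp_add]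
    ring_nf
  have hac : μ ≪ ν := by
    rw [hμν]
    exact withDensity_absolutelyContinuous _ _
  have hrn : μ.rnDeriv ν =ᵐ[ν] fun a => ENNReal.ofReal (Real.exp (f a - g a)) := by
    conv_lhs => rw [hμν]
    exact Measure.rnDeriv_withDensity ν (by fun_prop)
  have hllr : llr μ ν =ᵐ[μ] fun a => f a - g a := by
    filter_upwards [hac.ae_le hrn] with a ha
    rw [llr, ha, ENNReal.toReal_ofReal (Real.exp_nonneg _), Real.log_exp]
  rw [klDiv_of_ac_of_integrable hac (hint.congr hllr.symm), integral_congr_ae hllr]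
  simp

/-- Among all products of probability measures with the second marginal of `ρ`, the product of the marginals is
the closest to `ρ` in Kullback-Leibler divergence. -/
lemma InformationTheory.klDiv_prod_marginals_le [StandardBorelSpace β] [Nonempty β]
    (ρ : Measure (α × β)) [IsProbabilityMeasure ρ] (G : Measure α) [IsProbabilityMeasure G] :
    klDiv ρ (ρ.fst.prod ρ.snd) ≤ klDiv ρ (G.prod ρ.snd) := by
  have h := klDiv_compProd_eq_add ρ.fst G ρ.condKernel (Kernel.const α ρ.snd)
  rw [ρ.disintegrate ρ.condKernel, Measure.compProd_const, Measure.compProd_const] at h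
  rw [h]
  exact le_add_self

/-- The shear `(x, r) ↦ (x, x + r)` turns a density of the noise into a joint density. -/
lemma ProbabilityTheory.IndepFun.map_prodMk_add_eq_withDensity {Ω E : Type*} [MeasurableSpace Ω]
    {P : Measure Ω} [IsProbabilityMeasure P] [AddCommGroup E] [MeasurableSpace E]
    [MeasurableAdd₂ E] [MeasurableNeg E] [MeasurableSub₂ E] {lam : Measure E} [SFinite lam]
    [lam.IsAddLeftInvariant] {x r : Ω → E}
    (hx : AEMeasurable x P) (hr : AEMeasurable r P) (h : IndepFun x r P) {k : E → ENNReal}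
    (hk : Measurable k) (hrk : P.map r = lam.withDensity k) :
    P.map (fun ω => (x ω, x ω + r ω)) =
      ((P.map x).prod lam).withDensity fun z => k (z.2 - z.1) := by
  have := Measure.isProbabilityMeasure_map hx (μ := P)
  let e : E × E ≃ᵐ E × E := MeasurableEquiv.shearAddRight E
  have he (z : E × E) : e z = (z.1, z.1 + z.2) := rfl
  have hpres : ((P.map x).prod lam).map e = (P.map x).prod lam :=
    (measurePreserving_prod_add (P.map x) lam).map_eq
  have hcomp : (fun ω => (x ω, x ω + r ω)) = e ∘ fun ω => (x ω, r ω) := rfl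
  rw [hcomp, ← AEMeasurable.map_map_of_aemeasurable e.measurable.aemeasurable (hx.prodMk hr),
    (indepFun_iff_map_prod_eq_prod_map_map hx hr).1 h, hrk, prod_withDensity_right hk]
  have hsub : (fun z : E × E => k z.2) = fun z => k ((e z).2 - (e z).1) := by
    ext z; simp [he]
  rw [hsub, Measure.map_withDensity_comp _ e (f := fun z => k (z.2 - z.1)) (by fun_prop), hpres]

lemma mutualInformation_comp_right_le {Ω γ : Type*} [MeasurableSpace Ω] [MeasurableSpace γ]
    {P : Measure Ω} [IsProbabilityMeasure P] {X : Ω → α} {Y : Ω → β} (hX : AEMeasurable X P)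
    (hY : AEMeasurable Y P) {g : β → γ} (hg : Measurable g) :
    mutualInformation X (fun ω => g (Y ω)) P ≤ mutualInformation X Y P := by
  have := Measure.isProbabilityMeasure_map hX
  have := Measure.isProbabilityMeasure_map hY
  have := Measure.isProbabilityMeasure_map (hX.prodMk hY)
  have h := klDiv_map_le (μ := P.map fun ω => (X ω, Y ω)) (ν := (P.map X).prod (P.map Y))
    (g := Prod.map id g) (by fun_prop)
  rwa [AEMeasurable.map_map_of_aemeasurable (by fun_prop) (hX.prodMk hY),
    ← Measure.map_prod_map _ _ measurable_id hg, Measure.map_id,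
    AEMeasurable.map_map_of_aemeasurable (by fun_prop) hY] at h

/-- The capacity bound of the additive Gaussian channel: comparing the joint law of output and input
with `N(c, C + S) ⊗ P_x`, where `c` and `C + S` are the mean and covariance of the output. -/
lemma mutualInformation_add_gaussian_le {Ω ι : Type*} [MeasurableSpace Ω] {P : Measure Ω}
    [IsProbabilityMeasure P] [Fintype ι] [DecidableEq ι] {x r : Ω → EuclideanSpace ℝ ι}
    {m : EuclideanSpace ℝ ι} {S : Matrix ι ι ℝ} (hS : S.PosDef) (hx : MemLp x 2 P)
    (hr : HasLaw r (multivariateGaussian m S) P) (hxr : IndepFun x r P) :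
    mutualInformation (fun ω => x ω + r ω) x P ≤
      ENNReal.ofReal ((Real.log (covarianceMatrix x P + S).det - Real.log S.det) / 2) := by
  have hr2 : MemLp r 2 P := by
    have : MemLp id 2 (P.map r) := by
      rw [hr.map_eq]
      exact IsGaussian.memLp_two_id
    exact this.comp_of_map hr.aemeasurable
  have hrmean (i : ι) : ∫ ω, r ω i ∂P = m i := by
    have h1 := integral_map hr.aemeasurable (μ := P)
      (f := fun v : EuclideanSpace ℝ ι => v i) (by fun_prop)
    have h2 := (EuclideanSpace.proj (𝕜 := ℝ) i).integral_comp_id_comm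
      (IsGaussian.integrable_id (μ := multivariateGaussian m S))
    rw [integral_id_multivariateGaussian] at h2
    rw [← h1, hr.map_eq]
    exact h2
  have hrcov : covarianceMatrix r P = S := by
    ext i j
    rw [← covariance_eval_multivariateGaussian (μ := m) hS.posSemidef i j, ← hr.map_eq,
      covariance_map_fun (by fun_prop) (by fun_prop) hr.aemeasurable]
    rfl
  set K := covarianceMatrix x P + S
  have hK : K.PosDef := Matrix.PosDef.posSemidef_add (posSemidef_covarianceMatrix hx) hS
  have hxr2 : MemLp (fun ω => x ω + r ω) 2 P := hx.add hr2
  have hKcov : covarianceMatrix (fun ω => x ω + r ω) P = K := by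
    rw [covarianceMatrix_add_of_indepFun hx hr2 hxr, hrcov]
  let c : EuclideanSpace ℝ ι := WithLp.toLp 2 fun i => ∫ ω, (x ω + r ω) i ∂P
  obtain ⟨hi1, hv1⟩ := integrable_and_integral_gaussianLogDensity hr2 hrmean hrcov hS
  obtain ⟨hi2, hv2⟩ := integrable_and_integral_gaussianLogDensity hxr2 (c := c) (fun i => rfl)
    hKcov hK
  have hxm := hx.aestronglyMeasurable.aemeasurable
  have hrm := hr.aemeasurable
  have hjm : AEMeasurable (fun ω => (x ω, x ω + r ω)) P := hxm.prodMk (hxm.add hrm)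
  have hjm' : AEMeasurable (fun ω => (x ω + r ω, x ω)) P := (hxm.add hrm).prodMk hxm
  have := Measure.isProbabilityMeasure_map hxm
  have := Measure.isProbabilityMeasure_map hjm
  have := Measure.isProbabilityMeasure_map hjm'
  have hJ := hxr.map_prodMk_add_eq_withDensity hxm hrm (lam := volume)
    (k := fun v => ENNReal.ofReal (Real.exp (gaussianLogDensity m S v))) (by fun_prop)
    (by rw [hr.map_eq, multivariateGaussian_eq_withDensity m hS])
  have hN : (P.map x).prod (multivariateGaussian c K) =
      ((P.map x).prod volume).withDensity fun z =>
        ENNReal.ofReal (Real.exp (gaussianLogDensity c K z.2)) := by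
    rw [multivariateGaussian_eq_withDensity c hK, prod_withDensity_right (by fun_prop)]
  have hmeas : Measurable fun z : EuclideanSpace ℝ ι × EuclideanSpace ℝ ι =>
      gaussianLogDensity m S (z.2 - z.1) - gaussianLogDensity c K z.2 := by fun_prop
  have hcomp (ω : Ω) : gaussianLogDensity m S ((x ω, x ω + r ω).2 - (x ω, x ω + r ω).1) -
      gaussianLogDensity c K (x ω, x ω + r ω).2 =
      gaussianLogDensity m S (r ω) - gaussianLogDensity c K (x ω + r ω) := by simp
  have hkl := klDiv_withDensity_exp (by fun_prop) (by fun_prop) hJ hN (by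
    rw [integrable_map_measure hmeas.aestronglyMeasurable hjm]
    exact (hi1.sub hi2).congr (.of_forall fun ω => (hcomp ω).symm))
  rw [integral_map hjm hmeas.aestronglyMeasurable] at hkl
  simp_rw [hcomp] at hkl
  rw [integral_sub hi1 hi2, hv1, hv2] at hkl
  have hswap := klDiv_map_le (μ := P.map fun ω => (x ω, x ω + r ω))
    (ν := (P.map x).prod (multivariateGaussian c K)) measurable_swap
  rw [AEMeasurable.map_map_of_aemeasurable (by fun_prop) hjm, Measure.prod_swap, hkl] at hswap
  have hfst : (P.map fun ω => (x ω + r ω, x ω)).fst = P.map fun ω => x ω + r ω :=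
    Measure.fst_map_prodMk₀ hxm
  have hsnd : (P.map fun ω => (x ω + r ω, x ω)).snd = P.map x :=
    Measure.snd_map_prodMk₀ (hxm.add hrm)
  have hmarg := klDiv_prod_marginals_le (P.map fun ω => (x ω + r ω, x ω))
    (multivariateGaussian c K)
  rw [hfst, hsnd] at hmarg
  refine (hmarg.trans hswap).trans_eq ?_
  congr 1
  ring

end Information

/-! ### The bound in terms of the eigenvalues of the covariance matrix -/

theorem mainTheorem2 {Ω : Type*} [MeasurableSpace Ω] (P : Measure Ω) [IsProbabilityMeasure P]
    (n : ℕ) (x r : Ω → EuclideanSpace ℝ (Fin n)) (m : EuclideanSpace ℝ (Fin n)) (σ : Fin n → ℝ)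
    (hσ : ∀ i, 0 < σ i)
    (hx : MemLp x 2 P)
    (hr : HasLaw r (multivariateGaussian m (Matrix.diagonal fun i => σ i ^ 2)) P)
    (hxr : IndepFun x r P)
    (U : Finset (Fin n)) :
    (∃ (Q : Matrix (Fin n) (Fin n) ℝ) (lam : Fin n → ℝ),
      IsEigendecomposition (covarianceMatrix x P) Q lam ∧ Antivary lam σ) ∧
    ∀ (Q : Matrix (Fin n) (Fin n) ℝ) (lam : Fin n → ℝ),
      IsEigendecomposition (covarianceMatrix x P) Q lam →
      (Antivary lam σ ∨ Commute Q (Matrix.diagonal fun i => σ i ^ 2)) →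
      mutualInformation (fun ω => x ω + r ω) (fun ω => fun i : U => x ω i) P ≤
        ENNReal.ofReal (1 / 2 * Real.log ((2 * Real.pi * Real.exp 1) ^ n *
          ∏ i, (1 + lam i / σ i ^ 2))) := by
  refine ⟨(isHermitian_covarianceMatrix x).exists_isEigendecomposition_antivary σ, ?_⟩
  intro Q lam ⟨hQ, hA⟩ hcase
  set s : Fin n → ℝ := fun i => σ i ^ 2
  have hs i : 0 < s i := pow_pos (hσ i) 2
  have hC := posSemidef_covarianceMatrix hx
  have hD : (Matrix.diagonal s).PosDef := Matrix.PosDef.diagonal hs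
  have hlam i : 0 ≤ lam i := by
    have hQ2 : Q.transpose * Q = 1 := by
      simpa [Matrix.star_eq_conjTranspose] using (Matrix.mem_orthogonalGroup_iff' (Fin n) ℝ).1 hQ
    have h := hC.conjTranspose_mul_mul_same Q
    rw [Matrix.conjTranspose_eq_transpose_of_trivial, hA, Matrix.mul_assoc, Matrix.mul_assoc, hQ2,
      Matrix.mul_one, ← Matrix.mul_assoc, hQ2, Matrix.one_mul] at h
    exact Matrix.posSemidef_diagonal_iff.1 h i
  have hpi : 2 ≤ 2 * Real.pi * Real.exp 1 := by
    nlinarith [Real.pi_gt_three, Real.add_one_le_exp 1]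
  have hdet : (covarianceMatrix x P + Matrix.diagonal s).det ≤
      (2 * Real.pi * Real.exp 1) ^ n * ∏ i, (lam i + s i) := by
    have hprod : 0 ≤ ∏ i, (lam i + s i) :=
      Finset.prod_nonneg fun i _ => add_nonneg (hlam i) (hs i).le
    rw [hA]
    rcases hcase with h | h
    · have hanti : Antivary lam s := fun i j hij => h (lt_of_pow_lt_pow_left₀ 2 (hσ j).le hij)
      refine (Matrix.det_conj_diagonal_add_diagonal_le_of_antivary hQ hlam hs hanti).trans ?_
      rw [Finset.prod_mul_distrib, Finset.prod_const, Finset.card_univ, Fintype.card_fin]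
      gcongr
    · rw [Matrix.det_conj_diagonal_add_diagonal_of_commute hQ h]
      exact le_mul_of_one_le_left hprod (one_le_pow₀ (by linarith))
  have hdetpos : 0 < (covarianceMatrix x P + Matrix.diagonal s).det :=
    (Matrix.PosDef.posSemidef_add hC hD).det_pos
  have hsprod : 0 < ∏ i, s i := Finset.prod_pos fun i _ => hs i
  refine (mutualInformation_comp_right_le
    (hx.aestronglyMeasurable.aemeasurable.add hr.aemeasurable)
    hx.aestronglyMeasurable.aemeasurable (g := fun v => fun i : U => v i) (by fun_prop)).trans ?_
  refine (mutualInformation_add_gaussian_le hD hx hr hxr).trans (ENNReal.ofReal_le_ofReal ?_)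
  rw [Matrix.det_diagonal, ← Real.log_div hdetpos.ne' hsprod.ne', div_eq_inv_mul, ← one_div]
  refine mul_le_mul_of_nonneg_left (Real.log_le_log (div_pos hdetpos hsprod) ?_) (by norm_num)
  have hfac : ∏ i, (1 + lam i / s i) = (∏ i, (lam i + s i)) / ∏ i, s i := by
    rw [← Finset.prod_div_distrib]
    refine Finset.prod_congr rfl fun i _ => ?_
    have := (hs i).ne'
    field_simp
    ring
  rw [hfac, ← mul_div_assoc]
  exact div_le_div_of_nonneg_right hdet hsprod.le
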